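/- Let $X_1,X_2,\dots$ be i.i.d. observations, and let $\alpha,\beta\in\mathbb{R}$ and $\sigma_1,\sigma_2>0$. For each $n$ let $\hat\alpha,\hat\beta,s_1,s_2$ be real-valued measurable functions of a sample of size $n$. Assume that, when they are computed from $X_1,\dots,X_n$ and $n\to\infty$, $$n^{1/2}\begin{pmatrix}\hat\alpha-\alpha\\ \hat\beta-\beta\end{pmatrix}\implies N\left(\begin{pmatrix}0\\0\end{pmatrix},\begin{pmatrix}\sigma_1^2&0\\0&\sigma_2^2\end{pmatrix}\right),$$ where $\implies$ denotes weak convergence, and that $s_1^2\to\sigma_1^2$ and $s_2^2\to\sigma_2^2$ in probability. The Sobel statistic of a sample of size $m$ is $$S=\frac{m^{1/2}\hat\alpha\hat\beta}{(\hat\alpha^2s_2^2+\hat\beta^2s_1^2)^{1/2}},$$ with all four estimators computed from that sample. Fix $K\ge 2$. For each $n$ let $\mathcal{G}_1,\dots,\mathcal{G}_K$ be a partition of $\{1,\dots,n\}$, deterministic or random but independent of $(X_1,\dots,X_n)$, such that for every $i$ the size $|\mathcal{G}_i|$ tends to infinity (in probability, if the partition is random) as $n\to\infty$. Let $S_{\mathcal{G}_i}$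 be the Sobel statistic of the subsample $(X_j)_{j\in\mathcal{G}_i}$, let $\bar S_K=K^{-1}\sum_{i=1}^K S_{\mathcal{G}_i}$, and let $$\mathcal{T}_n=\frac{K^{1/2}\bar S_K}{\left\{\frac1{K-1}\sum_{i=1}^K(S_{\mathcal{G}_i}-\bar S_K)^2\right\}^{1/2}},$$ where ratios with zero denominator are set to $0$. If $\alpha\beta=0$ (that is, under each of $H_{00}:\alpha=\beta=0$, $H_{01}:\alpha=0,\beta\ne0$ and $H_{10}:\alpha\ne0,\beta=0$), then, as $n\to\infty$, $$\mathcal{T}_n\implies\frac{K^{1/2}\bar Z_K}{\left\{\frac1{K-1}\sum_{i=1}^K(Z_i-\bar Z_K)^2\right\}^{1/2}}\sim t_{K-1},$$ where $Z_1,\dots,Z_K$ are i.i.d. $N(0,1)$, $\bar Z_K=K^{-1}\sum_{i=1}^K Z_i$, and $t_{K-1}$ is the Student $t$ distribution with $K-1$ degrees of freedom. -/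

import Mathlib

open MeasureTheory ProbabilityTheory Filter Topology

/-- A rule which computes, from a sample of any size `n` of observations in `𝒳`, the estimators
`α̂`, `β̂` and the scale estimators `s₁`, `s₂` (so that `s₁²`, `s₂²` estimate variances).
All four are measurable functions of the sample. -/
structure MediationEstimators (𝒳 : Type*) [MeasurableSpace 𝒳] where
  alphaHat : (n : ℕ) → (Fin n → 𝒳) → ℝ
  betaHat : (n : ℕ) → (Fin n → 𝒳) → ℝ
  s₁ : (n : ℕ) → (Fin n → 𝒳) → ℝ
  s₂ : (n : ℕ) → (Fin n → 𝒳) → ℝ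
  measurable_alphaHat : ∀ n, Measurable (alphaHat n)
  measurable_betaHat : ∀ n, Measurable (betaHat n)
  measurable_s₁ : ∀ n, Measurable (s₁ n)
  measurable_s₂ : ∀ n, Measurable (s₂ n)

namespace MediationEstimators

variable {𝒳 : Type*} [MeasurableSpace 𝒳]

/-- The Sobel statistic `n^{1/2} α̂ β̂ / (α̂² s₂² + β̂² s₁²)^{1/2}` of a sample `x` of size `n`. -/
noncomputable def sobel (E : MediationEstimators 𝒳) (n : ℕ) (x : Fin n → 𝒳) : ℝ :=
  Real.sqrt n * E.alphaHat n x * E.betaHat n x /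
    Real.sqrt (E.alphaHat n x ^ 2 * E.s₂ n x ^ 2 + E.betaHat n x ^ 2 * E.s₁ n x ^ 2)

/-- Joint asymptotic normality: along the samples `(X₀, …, X_{n-1})`,
`n^{1/2} (α̂ - α, β̂ - β)` converges weakly to `N(0, diag(σ₁², σ₂²))`. -/
def AsymptoticallyNormal (E : MediationEstimators 𝒳) {Ω : Type*} [MeasurableSpace Ω]
    (P : Measure Ω) [IsProbabilityMeasure P] (X : ℕ → Ω → 𝒳) (α β σ₁ σ₂ : ℝ) : Prop :=
  TendstoInDistribution
    (fun (n : ℕ) (ω : Ω) =>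
      (!₂[Real.sqrt n * (E.alphaHat n (fun j => X j ω) - α),
          Real.sqrt n * (E.betaHat n (fun j => X j ω) - β)] : EuclideanSpace ℝ (Fin 2)))
    atTop id (fun _ => P)
    (multivariateGaussian (0 : EuclideanSpace ℝ (Fin 2)) (Matrix.diagonal ![σ₁ ^ 2, σ₂ ^ 2]))

/-- Along the samples `(X₀, …, X_{n-1})`, `s₁²` and `s₂²` converge in probability to `σ₁²` and
`σ₂²`. -/
def ConsistentVariances (E : MediationEstimators 𝒳) {Ω : Type*} [MeasurableSpace Ω]
    (P : Measure Ω) (X : ℕ → Ω → 𝒳) (σ₁ σ₂ : ℝ) : Prop :=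
  TendstoInMeasure P (fun (n : ℕ) ω => E.s₁ n (fun j => X j ω) ^ 2) atTop (fun _ => σ₁ ^ 2) ∧
  TendstoInMeasure P (fun (n : ℕ) ω => E.s₂ n (fun j => X j ω) ^ 2) atTop (fun _ => σ₂ ^ 2)

end MediationEstimators

/-- The `i`-th of the `K` disjoint index sets into which a labelling `g` splits the `n` indices. -/
def splitPart {n K : ℕ} (g : Fin n → Fin K) (i : Fin K) : Finset (Fin n) :=
  Finset.univ.filter (fun j => g j = i)

/-- The observations with index in `G`, listed in increasing order of their index. -/
def subsample {𝒳 : Type*} {n : ℕ} (x : Fin n → 𝒳) (G : Finset (Fin n)) : Fin G.card → 𝒳 :=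
  fun j => x (G.orderEmbOfFin rfl j)

/-- The mean of `K` real numbers. -/
noncomputable def sampleMean {K : ℕ} (v : Fin K → ℝ) : ℝ := (∑ i, v i) / K

/-- The studentized mean `K^{1/2} v̄ / ((K - 1)⁻¹ ∑ᵢ (vᵢ - v̄)²)^{1/2}` of `K` real numbers. -/
noncomputable def studentizedMean {K : ℕ} (v : Fin K → ℝ) : ℝ :=
  Real.sqrt K * sampleMean v /
    Real.sqrt ((1 / ((K : ℝ) - 1)) * ∑ i, (v i - sampleMean v) ^ 2)

/-- The subsampling-based t-statistic of the data `x`, split according to the labelling `g`. -/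
noncomputable def subsamplingT {𝒳 : Type*} [MeasurableSpace 𝒳] (E : MediationEstimators 𝒳)
    {n K : ℕ} (g : Fin n → Fin K) (x : Fin n → 𝒳) : ℝ :=
  studentizedMean (fun i : Fin K => E.sobel (splitPart g i).card (subsample x (splitPart g i)))

/-- The Student `t` distribution with `ν` degrees of freedom, through its density. -/
noncomputable def studentT (ν : ℝ) : Measure ℝ :=
  volume.withDensity (fun x => ENNReal.ofReal
    (Real.Gamma ((ν + 1) / 2) / (Real.sqrt (ν * Real.pi) * Real.Gamma (ν / 2)) *
      (1 + x ^ 2 / ν) ^ (-((ν + 1) / 2))))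

/-!
The proof has two halves.

*Convergence.* Under `α * β = 0` the Sobel statistic of a single sample of size `m` converges weakly
to a centred normal law, and the only effect of the particular null configuration is on its scale.
If exactly one of `α`, `β` vanishes, the limit is standard normal (Slutsky's theorem, with
`α̂ = α + m^{-1/2} · (m^{1/2}(α̂ - α))` and likewise for `β̂`). If both vanish, the limit is
`G₁ G₂ / (G₁² + G₂²)^{1/2}` for independent standard normals `G₁`, `G₂`. In polar coordinates this
is `(R / 2) sin 2θ`; doubling the angle preserves the uniform law on the circle, so it has the law of
`G₂ / 2`. Both cases are collected in `MediationEstimators.exists_tendstoInDistribution_sobel`.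
Given the labelling, the statistics of the `K` subsamples are independent, and each has the law of
the statistic of an initial sample of the same size. Weak convergence of product measures, followed
by integration over the labelling, which is independent of the data, gives joint convergence to `K`
independent normals with a common scale (`tendstoInDistribution_subsampleStatistics`). The
studentized mean is invariant under scaling and is continuous off the diagonal, a null set for the
limit law, so the continuous mapping theorem applies
(`tendstoInDistribution_comp_of_ae_continuousAt`).

*The limit law.* A rotation taking the unit vector `K^{-1/2} (1, …, 1)` to the first coordinate vector
preserves the standard Gaussian law and turns the studentized mean into
`Y₀ / ((K - 1)⁻¹ ∑_{i ≥ 1} Yᵢ²)^{1/2}`. Conditionally on the denominator this is a centred Gaussian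
variable; averaging its density over the denominator is a radial integral, which produces the density
of Student's law (`map_div_sqrt_sum_sq_eq_studentT`, `map_studentizedMean_pi_gaussianReal`).
-/

open scoped ENNReal NNReal

/-! ### Convergence in distribution and in measure -/

/-- **Continuous mapping theorem** for a map that is continuous at almost every point of the limit. -/
theorem tendstoInDistribution_comp_of_ae_continuousAt
    {ι E F Ω' : Type*} {Ω : ι → Type*} {m : ∀ i, MeasurableSpace (Ω i)}
    {μ : (i : ι) → Measure (Ω i)} [∀ i, IsProbabilityMeasure (μ i)]
    {m' : MeasurableSpace Ω'} {μ' : Measure Ω'} [IsProbabilityMeasure μ']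
    [TopologicalSpace E] [MeasurableSpace E] [OpensMeasurableSpace E] [HasOuterApproxClosed E]
    [TopologicalSpace F] [MeasurableSpace F] [OpensMeasurableSpace F] [HasOuterApproxClosed F]
    {X : (i : ι) → Ω i → E} {l : Filter ι} [l.IsCountablyGenerated] {Z : Ω' → E} {h : E → F}
    (hX : TendstoInDistribution X l Z μ μ') (hh : Measurable h)
    (hcont : ∀ᵐ ω ∂μ', ContinuousAt h (Z ω)) :
    TendstoInDistribution (fun i ω => h (X i ω)) l (fun ω => h (Z ω)) μ μ' where
  forall_aemeasurable i := hh.comp_aemeasurable (hX.forall_aemeasurable i)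
  aemeasurable_limit := hh.comp_aemeasurable hX.aemeasurable_limit
  tendsto := by
    rcases l.eq_or_neBot with rfl | hl
    · exact tendsto_bot
    refine tendsto_of_forall_isClosed_limsup_le' fun C hC => ?_
    have key := ProbabilityMeasure.limsup_measure_closed_le_of_tendsto hX.tendsto
      (isClosed_closure (s := h ⁻¹' C))
    have hlim : μ'.map Z (closure (h ⁻¹' C)) ≤ μ'.map (fun ω => h (Z ω)) C := by
      rw [Measure.map_apply_of_aemeasurable hX.aemeasurable_limit isClosed_closure.measurableSet,
        Measure.map_apply_of_aemeasurable
          (f := fun ω => h (Z ω)) (hh.comp_aemeasurable hX.aemeasurable_limit)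
          hC.measurableSet]
      refine measure_mono_ae ?_
      filter_upwards [hcont] with ω hω hmem
      -- at a continuity point, being adherent to `h ⁻¹' C` forces the value to lie in `C`
      exact hC.closure_subset (hω.continuousWithinAt.mem_closure hmem fun _ hx => hx)
    have hle : ∀ i, (μ i).map (fun ω => h (X i ω)) C ≤ (μ i).map (X i) (closure (h ⁻¹' C)) := by
      intro i
      rw [Measure.map_apply_of_aemeasurable (hX.forall_aemeasurable i)
          isClosed_closure.measurableSet,
        Measure.map_apply_of_aemeasurable
          (f := fun ω => h (X i ω)) (hh.comp_aemeasurable (hX.forall_aemeasurable i))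
          hC.measurableSet]
      exact measure_mono fun ω hω => subset_closure hω
    exact ((limsup_le_limsup (Eventually.of_forall hle)).trans key).trans hlim

theorem MeasureTheory.TendstoInMeasure.prodMk {α ι E F : Type*} [MeasurableSpace α]
    {μ : Measure α} [PseudoEMetricSpace E] [PseudoEMetricSpace F] {l : Filter ι}
    {f : ι → α → E} {g : ι → α → F} {f' : α → E} {g' : α → F}
    (hf : TendstoInMeasure μ f l f') (hg : TendstoInMeasure μ g l g') :
    TendstoInMeasure μ (fun i a => (f i a, g i a)) l (fun a => (f' a, g' a)) := by
  intro ε hε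
  have := (hf ε hε).add (hg ε hε)
  rw [add_zero] at this
  refine tendsto_of_tendsto_of_tendsto_of_le_of_le tendsto_const_nhds this (fun _ => zero_le)
    fun i => (measure_mono ?_).trans (measure_union_le _ _)
  intro a ha
  simpa [Prod.edist_eq] using ha

/-! ### Statistics of the subsamples of a split sample -/

theorem measurable_subsample {𝒳 : Type*} [MeasurableSpace 𝒳] {n : ℕ} (G : Finset (Fin n)) :
    Measurable (fun x : Fin n → 𝒳 => subsample x G) :=
  measurable_pi_lambda _ fun _ => measurable_pi_apply _

theorem map_sample_eq_pi {𝒳 Ω : Type*} [MeasurableSpace 𝒳] [MeasurableSpace Ω]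
    {P : Measure Ω} [IsProbabilityMeasure P] {X : ℕ → Ω → 𝒳} (hX : ∀ j, Measurable (X j))
    (hindep : iIndepFun X P) (hident : ∀ j, IdentDistrib (X j) (X 0) P P) (m : ℕ) :
    P.map (fun ω (j : Fin m) => X j ω) = Measure.pi (fun _ => P.map (X 0)) := by
  rw [iIndepFun.map_fun_eq_pi_map (f := fun (j : Fin m) => X j) (fun j => (hX j).aemeasurable)
    (hindep.precomp Fin.val_injective)]
  simp_rw [fun j => (hident j).map_eq]

/-- The subsamples of an i.i.d. sample along a deterministic labelling are independent i.i.d.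
samples. -/
theorem map_subsample_eq_pi {𝒳 : Type*} [MeasurableSpace 𝒳]
    (ν : Measure 𝒳) [IsProbabilityMeasure ν] {n K : ℕ} (c : Fin n → Fin K) :
    (Measure.pi fun _ : Fin n => ν).map (fun x i => subsample x (splitPart c i)) =
      Measure.pi fun i => Measure.pi fun _ : Fin (splitPart c i).card => ν := by
  let e : ((i : Fin K) × Fin (splitPart c i).card) → Fin n :=
    fun p => (splitPart c p.1).orderEmbOfFin rfl p.2
  have he : Function.Injective e := by
    rintro ⟨i, a⟩ ⟨i', a'⟩ h
    have h1 : ∀ p, c (e p) = p.1 := fun p => by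
      exact (Finset.mem_filter.1 ((splitPart c p.1).orderEmbOfFin_mem rfl p.2)).2
    obtain rfl : i = i' := (h1 ⟨i, a⟩).symm.trans ((congrArg c h).trans (h1 ⟨i', a'⟩))
    obtain rfl : a = a' := ((splitPart c i).orderEmbOfFin rfl).injective h
    rfl
  -- restrict to the labelled pairs `(i, j)`, then curry
  have hfac : (fun (x : Fin n → 𝒳) i => subsample x (splitPart c i)) =
      MeasurableEquiv.piCurry (fun (i : Fin K) (_ : Fin (splitPart c i).card) => 𝒳) ∘
        fun x p => x (e p) := rfl
  rw [hfac, ← Measure.map_map (MeasurableEquiv.measurable _) (by fun_prop),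
    ← Measure.infinitePi_eq_pi, Measure.map_infinitePi_infinitePi_of_inj he]
  rw [Measure.infinitePi_map_piCurry (fun (i : Fin K) (_ : Fin (splitPart c i).card) => ν)]
  simp_rw [Measure.infinitePi_eq_pi]

/-- If a statistic of the first `m` observations converges weakly to `γ`, then its values on the `K`
parts of an independent random split, whose sizes tend to infinity in probability, converge jointly
to `K` independent variables of law `γ`. -/
theorem tendstoInDistribution_subsampleStatistics
    {𝒳 Ω Ω' : Type*} [MeasurableSpace 𝒳] [MeasurableSpace Ω] [MeasurableSpace Ω']
    {P : Measure Ω} [IsProbabilityMeasure P] {P' : Measure Ω'} [IsProbabilityMeasure P']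
    {X : ℕ → Ω → 𝒳} (hX : ∀ j, Measurable (X j)) (hindep : iIndepFun X P)
    (hident : ∀ j, IdentDistrib (X j) (X 0) P P)
    {T : (m : ℕ) → (Fin m → 𝒳) → ℝ} (hT : ∀ m, Measurable (T m))
    {γ : Measure ℝ} [IsProbabilityMeasure γ]
    (hlim : TendstoInDistribution (fun m ω => T m (fun j => X j ω)) atTop id (fun _ => P) γ)
    {K : ℕ} {g : (n : ℕ) → Ω → Fin n → Fin K} (hg : ∀ n, Measurable (g n))
    (hgX : ∀ n, IndepFun (g n) (fun ω (j : Fin n) => X j ω) P)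
    (hsize : ∀ (i : Fin K) (m : ℕ),
      Tendsto (fun n => P {ω | (splitPart (g n ω) i).card ≤ m}) atTop (𝓝 0))
    {W : Ω' → Fin K → ℝ} (hW : HasLaw W (Measure.pi fun _ => γ) P') :
    TendstoInDistribution
      (fun (n : ℕ) ω i => T (splitPart (g n ω) i).card
        (subsample (fun j => X j ω) (splitPart (g n ω) i))) atTop W (fun _ => P) P' := by
  set ν := P.map (X 0) with hν
  have : IsProbabilityMeasure ν := Measure.isProbabilityMeasure_map (hX 0).aemeasurable
  -- the law of the statistic of a sample of size `m`
  let L : ℕ → ProbabilityMeasure ℝ := fun m => ⟨(Measure.pi fun _ : Fin m => ν).map (T m),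
    Measure.isProbabilityMeasure_map (hT m).aemeasurable⟩
  have hL : Tendsto L atTop (𝓝 ⟨γ, inferInstance⟩) := by
    have hlaw : ∀ m, (Measure.pi fun _ : Fin m => ν).map (T m) =
        P.map fun ω => T m fun j => X j ω := fun m => by
      rw [← map_sample_eq_pi hX hindep hident m, Measure.map_map (hT m) (by fun_prop)]
      rfl
    have := hlim.tendsto
    simp only [Measure.map_id, ← hlaw] at this
    exact this
  let S : (n : ℕ) → (Fin n → Fin K) × (Fin n → 𝒳) → Fin K → ℝ :=
    fun n p i => T (splitPart p.1 i).card (subsample p.2 (splitPart p.1 i))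
  have hS : ∀ n, Measurable (S n) := fun n => measurable_from_prod_countable_right fun c =>
    measurable_pi_lambda _ fun i =>
      (hT (splitPart c i).card).comp (measurable_subsample (splitPart c i))
  have hXn : ∀ n, Measurable (fun ω (j : Fin n) => X j ω) := fun n => by fun_prop
  have hSn : ∀ n, Measurable fun ω => S n (g n ω, fun j => X j ω) :=
    fun n => (hS n).comp ((hg n).prodMk (hXn n))
  refine ⟨fun n => (hSn n).aemeasurable, hW.aemeasurable, ?_⟩
  refine ProbabilityMeasure.tendsto_iff_forall_integral_tendsto.2 fun f => ?_
  let F : (Fin K → ℕ) → ℝ := fun m => ∫ y, f y ∂(Measure.pi fun i => (L (m i) : Measure ℝ))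
  have hF : Tendsto F (Filter.pi fun _ => atTop) (𝓝 (∫ y, f y ∂(Measure.pi fun _ => γ))) := by
    have h1 : Tendsto (fun (m : Fin K → ℕ) i => L (m i)) (Filter.pi fun _ => atTop)
        (𝓝 fun _ => ⟨γ, inferInstance⟩) :=
      tendsto_pi_nhds.2 fun i => hL.comp (tendsto_eval_pi _ i)
    exact ProbabilityMeasure.tendsto_iff_forall_integral_tendsto.1
      ((ProbabilityMeasure.continuous_pi.tendsto _).comp h1) f
  have hFb : ∀ m, ‖F m‖ ≤ ‖f‖ := fun m => by
    simpa using norm_integral_le_of_norm_le_const (μ := Measure.pi fun i => (L (m i) : Measure ℝ))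
      (Eventually.of_forall f.norm_coe_le_norm)
  -- by independence, the labelling can be integrated last
  have hint : ∀ n, ∫ y, f y ∂(P.map fun ω => S n (g n ω, fun j => X j ω)) =
      ∫ ω, F (fun i => (splitPart (g n ω) i).card) ∂P := by
    intro n
    have hfS : Measurable fun p => f (S n p) := f.continuous.measurable.comp (hS n)
    rw [integral_map (hSn n).aemeasurable f.continuous.aestronglyMeasurable,
      ← integral_map (φ := fun ω => (g n ω, fun j : Fin n => X j ω)) (f := fun p => f (S n p))
        ((hg n).prodMk (hXn n)).aemeasurable hfS.aestronglyMeasurable,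
      (hgX n).map_prod_eq_prod_map_map (hg n).aemeasurable (hXn n).aemeasurable]
    have : IsProbabilityMeasure (P.map (g n)) :=
      Measure.isProbabilityMeasure_map (hg n).aemeasurable
    rw [map_sample_eq_pi hX hindep hident n, ← hν, integral_prod,
      integral_map (hg n).aemeasurable
        (Measurable.of_discrete (α := Fin n → Fin K)).aestronglyMeasurable]
    · congr 1
      ext ω
      have hmap : (Measure.pi fun _ : Fin n => ν).map (fun x => S n (g n ω, x)) =
          Measure.pi fun i => (L (splitPart (g n ω) i).card : Measure ℝ) := by
        have : (fun x => S n (g n ω, x)) =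
            (fun (y : (i : Fin K) → Fin (splitPart (g n ω) i).card → 𝒳) i => T _ (y i)) ∘
            fun x i => subsample x (splitPart (g n ω) i) := rfl
        rw [this, ← Measure.map_map _ (measurable_pi_lambda _ fun i => measurable_subsample _),
          map_subsample_eq_pi, Measure.pi_map_pi fun i => (hT _).aemeasurable]
        · rfl
        · exact measurable_pi_lambda _ fun i => (hT _).comp (measurable_pi_apply i)
      simp only [F]
      rw [← hmap, integral_map (φ := fun x => S n (g n ω, x))
        ((hS n).comp measurable_prodMk_left).aemeasurable
        f.continuous.aestronglyMeasurable]
    · exact Integrable.of_bound hfS.aestronglyMeasurable ‖f‖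
        (Eventually.of_forall fun p => f.norm_coe_le_norm _)
  set I := ∫ y, f y ∂(Measure.pi fun _ : Fin K => γ) with hI
  have hFlim : Tendsto (fun n => ∫ ω, F (fun i => (splitPart (g n ω) i).card) ∂P) atTop (𝓝 I) := by
    rw [Metric.tendsto_nhds]
    intro ε hε
    obtain ⟨J, -, t, ht, hJ⟩ := Filter.mem_pi.1 (hF (Metric.ball_mem_nhds I (half_pos hε)))
    choose M hM using fun i => mem_atTop_sets.1 (ht i)
    have hbad : Tendsto (fun n => (‖f‖ + ‖I‖) *
        P.real (⋃ i, {ω | (splitPart (g n ω) i).card ≤ M i})) atTop (𝓝 0) := by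
      have h1 : Tendsto (fun n => P (⋃ i, {ω | (splitPart (g n ω) i).card ≤ M i})) atTop (𝓝 0) := by
        have h2 := tendsto_finsetSum Finset.univ fun i _ => hsize i (M i)
        rw [Finset.sum_const_zero] at h2
        exact tendsto_of_tendsto_of_tendsto_of_le_of_le tendsto_const_nhds h2 (fun _ => zero_le)
          fun n => measure_iUnion_fintype_le _ _
      have h3 := ((ENNReal.tendsto_toReal ENNReal.zero_ne_top).comp h1).const_mul (‖f‖ + ‖I‖)
      rwa [ENNReal.toReal_zero, mul_zero] at h3
    filter_upwards [hbad.eventually_lt_const (half_pos hε)] with n hn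
    have hcard : Measurable fun ω i => (splitPart (g n ω) i).card :=
      (Measurable.of_discrete (f := fun c : Fin n → Fin K => fun i => (splitPart c i).card)).comp
        (hg n)
    have hFm : Measurable fun ω => F fun i => (splitPart (g n ω) i).card :=
      (Measurable.of_discrete (f := F)).comp hcard
    set B := ⋃ i, {ω | (splitPart (g n ω) i).card ≤ M i} with hB
    have hBm : MeasurableSet B := MeasurableSet.iUnion fun i =>
      measurableSet_le (measurable_pi_iff.1 hcard i) measurable_const
    have hFi : Integrable (fun ω => F fun i => (splitPart (g n ω) i).card) P :=
      Integrable.of_bound hFm.aestronglyMeasurable ‖f‖ (Eventually.of_forall fun _ => hFb _)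
    have hpt : ∀ ω, ‖F (fun i => (splitPart (g n ω) i).card) - I‖ ≤
        ε / 2 + B.indicator (fun _ => ‖f‖ + ‖I‖) ω := by
      intro ω
      by_cases hω : ω ∈ B
      · rw [Set.indicator_of_mem hω]
        have := norm_sub_le (F fun i => (splitPart (g n ω) i).card) I
        linarith [hFb fun i => (splitPart (g n ω) i).card]
      · rw [Set.indicator_of_notMem hω, add_zero]
        have hmem : (fun i => (splitPart (g n ω) i).card) ∈ J.pi t := fun i _ => by
          refine hM i _ ?_
          simp only [hB, Set.mem_iUnion, Set.mem_ofPred_eq, not_exists, not_le] at hω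
          exact (hω i).le
        have := hJ hmem
        rw [Set.mem_preimage, Metric.mem_ball, dist_eq_norm] at this
        exact this.le
    have hsub : ∫ ω, F (fun i => (splitPart (g n ω) i).card) ∂P - I =
        ∫ ω, (F (fun i => (splitPart (g n ω) i).card) - I) ∂P := by
      rw [integral_sub hFi (integrable_const _)]
      simp
    rw [dist_eq_norm, hsub]
    calc ‖∫ ω, (F (fun i => (splitPart (g n ω) i).card) - I) ∂P‖
        ≤ ∫ ω, (ε / 2 + B.indicator (fun _ => ‖f‖ + ‖I‖) ω) ∂P :=
          norm_integral_le_of_norm_le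
            ((integrable_const _).add ((integrable_const _).indicator hBm))
            (Eventually.of_forall hpt)
      _ = ε / 2 + (‖f‖ + ‖I‖) * P.real B := by
          rw [integral_add (integrable_const _) ((integrable_const _).indicator hBm),
            integral_indicator_const _ hBm]
          simp [mul_comm]
      _ < ε := by linarith
  have hWl : ∫ y, f y ∂(P'.map W) = I := by rw [hW.map_eq]
  change Tendsto (fun n => ∫ y, f y ∂(P.map fun ω => S n (g n ω, fun j => X j ω))) atTop
    (𝓝 (∫ y, f y ∂(P'.map W)))
  rw [hWl]
  simp_rw [hint]
  exact hFlim

/-! ### The studentized mean -/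

theorem measurable_studentizedMean {K : ℕ} : Measurable (studentizedMean (K := K)) := by
  unfold studentizedMean sampleMean; fun_prop

theorem studentizedMean_smul {K : ℕ} {c : ℝ} (hc : 0 < c) (v : Fin K → ℝ) :
    studentizedMean (fun i => c * v i) = studentizedMean v := by
  have hm : sampleMean (fun i => c * v i) = c * sampleMean v := by
    simp only [sampleMean, ← Finset.mul_sum, mul_div_assoc]
  have hs : (1 / ((K : ℝ) - 1)) * ∑ i, (c * v i - c * sampleMean v) ^ 2 =
      c ^ 2 * ((1 / ((K : ℝ) - 1)) * ∑ i, (v i - sampleMean v) ^ 2) := by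
    simp only [← mul_sub, mul_pow, ← Finset.mul_sum]
    ring
  unfold studentizedMean
  rw [hm, hs, Real.sqrt_mul (sq_nonneg c), Real.sqrt_sq hc.le, mul_left_comm,
    mul_div_mul_left _ _ hc.ne']

theorem continuousAt_studentizedMean {K : ℕ} (hK : 2 ≤ K) {v : Fin K → ℝ} {i j : Fin K}
    (hv : v i ≠ v j) : ContinuousAt studentizedMean v := by
  have hK' : (0 : ℝ) < (K : ℝ) - 1 := by
    have : (2 : ℝ) ≤ K := by exact_mod_cast hK
    linarith
  have hpos : 0 < ∑ i, (v i - sampleMean v) ^ 2 := by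
    refine lt_of_le_of_ne (Finset.sum_nonneg fun i _ => sq_nonneg _) fun h => hv ?_
    have h0 := (Finset.sum_eq_zero_iff_of_nonneg fun i _ => sq_nonneg _).1 h.symm
    have hz : ∀ i, v i = sampleMean v := fun i => by
      have := h0 i (Finset.mem_univ i)
      nlinarith [pow_eq_zero_iff (two_ne_zero) |>.1 this]
    rw [hz i, hz j]
  have hcm : Continuous (sampleMean (K := K)) := by unfold sampleMean; fun_prop
  unfold studentizedMean
  refine ContinuousAt.div (by fun_prop) (by fun_prop) ?_
  exact (Real.sqrt_pos.2 (by positivity)).ne'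

theorem ae_pi_ne {K : ℕ} (γ : Measure ℝ) [IsProbabilityMeasure γ] [NullSingletonClass γ]
    {i j : Fin K} (hij : i ≠ j) : ∀ᵐ v ∂(Measure.pi fun _ : Fin K => γ), v i ≠ v j := by
  have hind : IndepFun (fun v : Fin K → ℝ => v i) (fun v => v j) (Measure.pi fun _ => γ) :=
    (iIndepFun_pi (X := fun _ x => x) (by fun_prop)).indepFun hij
  have hmap := hind.map_prod_eq_prod_map_map (measurable_pi_apply i).aemeasurable
    (measurable_pi_apply j).aemeasurable
  rw [(measurePreserving_eval (fun _ : Fin K => γ) i).map_eq,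
    (measurePreserving_eval (fun _ : Fin K => γ) j).map_eq] at hmap
  have hdiag : ∀ᵐ p ∂(γ.prod γ), p.1 ≠ p.2 := by
    refine (Measure.ae_prod_iff_ae_ae (p := fun p : ℝ × ℝ => p.1 ≠ p.2)
      (measurableSet_eq_fun measurable_fst measurable_snd).compl).2 ?_
    refine Eventually.of_forall fun x => ?_
    have : ∀ᵐ y ∂γ, y ≠ x := by simp [ae_iff]
    filter_upwards [this] with y hy using hy.symm
  rw [← hmap] at hdiag
  exact ae_of_ae_map (f := fun v : Fin K → ℝ => (v i, v j)) (by fun_prop) hdiag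

/-! ### The law of `G₁ G₂ / (G₁² + G₂²)^{1/2}` -/

/-- Doubling the angle preserves the uniform measure on the circle. -/
theorem setLIntegral_comp_sin_two_mul {h : ℝ → ℝ≥0∞} (hh : Measurable h) :
    ∫⁻ θ in Set.Ioo (-Real.pi) Real.pi, h (Real.sin (2 * θ)) =
      ∫⁻ θ in Set.Ioo (-Real.pi) Real.pi, h (Real.sin θ) := by
  have : Fact (0 < 2 * Real.pi) := ⟨Real.two_pi_pos⟩
  let F : AddCircle (2 * Real.pi) → ℝ := fun b => Real.Angle.sin b
  have hFc : Continuous F := Real.Angle.continuous_sin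
  have hF : Measurable F := hFc.measurable
  have hcirc := AddCircle.lintegral_preimage (2 * Real.pi) (-Real.pi)
  rw [show -Real.pi + 2 * Real.pi = Real.pi by ring] at hcirc
  have h1 := hcirc fun b => h (F b)
  have h2 := hcirc fun b => h (F (2 • b))
  have hsin : ∀ θ : ℝ, F (θ : AddCircle (2 * Real.pi)) = Real.sin θ := Real.Angle.sin_coe
  have hsin2 : ∀ θ : ℝ, F (2 • (θ : AddCircle (2 * Real.pi))) = Real.sin (2 * θ) := fun θ => by
    rw [← AddCircle.coe_nsmul, hsin, nsmul_eq_mul, Nat.cast_ofNat]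
  simp_rw [hsin] at h1
  simp_rw [hsin2] at h2
  rw [restrict_Ioo_eq_restrict_Ioc, h1, h2]
  exact (AddCircle.ergodic_nsmul one_lt_two).toMeasurePreserving.lintegral_comp (hh.comp hF)

/-- Integration in polar coordinates, as an iterated integral. -/
theorem lintegral_polar (f : ℝ × ℝ → ℝ≥0∞) (hf : Measurable f) :
    ∫⁻ p, f p = ∫⁻ r in Set.Ioi (0 : ℝ), ENNReal.ofReal r * ∫⁻ θ in Set.Ioo (-Real.pi) Real.pi,
      f (r * Real.cos θ, r * Real.sin θ) := by
  rw [← lintegral_comp_polarCoord_symm]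
  have : polarCoord.target = Set.Ioi (0 : ℝ) ×ˢ Set.Ioo (-Real.pi) Real.pi := rfl
  rw [this, Measure.volume_eq_prod, ← Measure.prod_restrict, lintegral_prod]
  · refine lintegral_congr fun r => ?_
    rw [← lintegral_const_mul]
    · rfl
    · fun_prop
  · simp only [polarCoord_symm_apply, smul_eq_mul]
    fun_prop

theorem gaussianReal_prod_eq_withDensity :
    (gaussianReal 0 1).prod (gaussianReal 0 1) = (volume : Measure (ℝ × ℝ)).withDensity
      (fun p => ENNReal.ofReal ((2 * Real.pi)⁻¹ * Real.exp (-(p.1 ^ 2 + p.2 ^ 2) / 2))) := by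
  rw [gaussianReal_of_var_ne_zero 0 one_ne_zero,
    prod_withDensity (measurable_gaussianPDF 0 1) (measurable_gaussianPDF 0 1)]
  rw [← Measure.volume_eq_prod]
  congr 1
  ext p
  simp only [gaussianPDF, gaussianPDFReal]
  rw [← ENNReal.ofReal_mul (by positivity)]
  congr 1
  have h2 : (√(2 * Real.pi))⁻¹ * (√(2 * Real.pi))⁻¹ = (2 * Real.pi)⁻¹ := by
    rw [← mul_inv, Real.mul_self_sqrt (by positivity)]
  simp only [NNReal.coe_one, mul_one, sub_zero]
  rw [mul_mul_mul_comm, h2, ← Real.exp_add]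
  ring_nf

/-- In polar coordinates the statistic is `r * sin (2 * θ) / 2`, which has the same law as
`r * sin θ / 2`, half of a coordinate. -/
theorem map_mul_div_sqrt_gaussianReal_prod :
    ((gaussianReal 0 1).prod (gaussianReal 0 1)).map
      (fun p => p.1 * p.2 / √(p.1 ^ 2 + p.2 ^ 2)) = gaussianReal 0 (1 / 4) := by
  have hmeas : Measurable fun p : ℝ × ℝ => p.1 * p.2 / √(p.1 ^ 2 + p.2 ^ 2) := by fun_prop
  have hhalf : ((gaussianReal 0 1).prod (gaussianReal 0 1)).map (fun p => p.2 / 2) =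
      gaussianReal 0 (1 / 4) := by
    have : (fun p : ℝ × ℝ => p.2 / 2) = (fun x => x / 2) ∘ Prod.snd := rfl
    rw [this, ← Measure.map_map (by fun_prop) measurable_snd, Measure.map_snd_prod]
    simp only [measure_univ, one_smul]
    rw [gaussianReal_map_div_const]
    congr 1
    · simp
    · ext; norm_num
  rw [← hhalf]
  have hpolar : ∀ G : ℝ × ℝ → ℝ≥0∞, Measurable G →
      ∫⁻ p, G p ∂((gaussianReal 0 1).prod (gaussianReal 0 1)) =
        ∫⁻ r in Set.Ioi (0 : ℝ), ENNReal.ofReal r * ∫⁻ θ in Set.Ioo (-Real.pi) Real.pi,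
          ENNReal.ofReal ((2 * Real.pi)⁻¹ *
            Real.exp (-((r * Real.cos θ) ^ 2 + (r * Real.sin θ) ^ 2) / 2)) *
          G (r * Real.cos θ, r * Real.sin θ) := fun G hG => by
    rw [gaussianReal_prod_eq_withDensity,
      lintegral_withDensity_eq_lintegral_mul _ (by fun_prop) hG, lintegral_polar _ (by fun_prop)]
    rfl
  refine Measure.ext_of_lintegral _ fun f hf => ?_
  rw [lintegral_map hf hmeas, lintegral_map hf (by fun_prop),
    hpolar (fun p => f (p.1 * p.2 / √(p.1 ^ 2 + p.2 ^ 2))) (hf.comp hmeas),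
    hpolar _ (by fun_prop)]
  refine setLIntegral_congr_fun measurableSet_Ioi fun r hr => ?_
  have hr : 0 < r := hr
  have hrad : ∀ θ, (r * Real.cos θ) ^ 2 + (r * Real.sin θ) ^ 2 = r ^ 2 := fun θ => by
    rw [mul_pow, mul_pow, ← mul_add, Real.cos_sq_add_sin_sq, mul_one]
  have hnum : ∀ θ, r * Real.cos θ * (r * Real.sin θ) / r = r * Real.sin (2 * θ) / 2 := fun θ => by
    rw [Real.sin_two_mul]
    field_simp
  simp only [hrad, Real.sqrt_sq hr.le, hnum]
  congr 1
  exact setLIntegral_comp_sin_two_mul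
    (h := fun s => ENNReal.ofReal ((2 * Real.pi)⁻¹ * Real.exp (-r ^ 2 / 2)) * f (r * s / 2))
    (by fun_prop)

/-! ### Gaussian limits and Slutsky's theorem -/

theorem ae_gaussianReal_ne_zero : ∀ᵐ x ∂(gaussianReal 0 1), x ≠ 0 := by
  have := nullSingletonClass_gaussianReal (μ := 0) one_ne_zero
  simp [ae_iff]

/-- Convergence in distribution depends on the limit only through its law. -/
theorem MeasureTheory.TendstoInDistribution.congr_law
    {ι E Ω' Ω'' : Type*} {Ω : ι → Type*} {m : ∀ i, MeasurableSpace (Ω i)}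
    {μ : (i : ι) → Measure (Ω i)} [∀ i, IsProbabilityMeasure (μ i)]
    {m' : MeasurableSpace Ω'} {μ' : Measure Ω'} [IsProbabilityMeasure μ']
    {m'' : MeasurableSpace Ω''} {μ'' : Measure Ω''} [IsProbabilityMeasure μ'']
    [TopologicalSpace E] [MeasurableSpace E] [OpensMeasurableSpace E]
    {X : (i : ι) → Ω i → E} {l : Filter ι} {Z : Ω' → E} {W : Ω'' → E}
    (hX : TendstoInDistribution X l Z μ μ') (hZW : IdentDistrib Z W μ' μ'') :
    TendstoInDistribution X l W μ μ'' where
  forall_aemeasurable := hX.forall_aemeasurable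
  aemeasurable_limit := hZW.aemeasurable_snd
  tendsto := by
    have := hX.tendsto
    simp only [hZW.map_eq] at this
    exact this

theorem map_gaussianReal_const_mul (σ : ℝ) :
    (gaussianReal 0 1).map (fun x => σ * x) = gaussianReal 0 (Real.toNNReal (σ ^ 2)) := by
  rw [gaussianReal_map_const_mul]
  congr 1
  · simp
  · ext; simp [sq_nonneg]

theorem map_gaussianReal_prod_eq_multivariateGaussian (σ₁ σ₂ : ℝ) :
    ((gaussianReal 0 1).prod (gaussianReal 0 1)).map
        (fun p => (!₂[σ₁ * p.1, σ₂ * p.2] : EuclideanSpace ℝ (Fin 2))) =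
      multivariateGaussian 0 (Matrix.diagonal ![σ₁ ^ 2, σ₂ ^ 2]) := by
  have hpos : (Matrix.diagonal ![σ₁ ^ 2, σ₂ ^ 2]).PosSemidef := by
    rw [Matrix.posSemidef_diagonal_iff]
    intro i
    fin_cases i <;> simp [sq_nonneg]
  have hfac : (fun p : ℝ × ℝ => (!₂[σ₁ * p.1, σ₂ * p.2] : EuclideanSpace ℝ (Fin 2))) ∘
      MeasurableEquiv.finTwoArrow = WithLp.toLp 2 ∘ fun x i => ![σ₁, σ₂] i * x i := by
    ext x i
    fin_cases i <;> simp
  rw [← (measurePreserving_finTwoArrow (gaussianReal 0 1)).map_eq,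
    Measure.map_map (by fun_prop) (MeasurableEquiv.measurable _), hfac,
    ← Measure.map_map (by fun_prop) (by fun_prop),
    Measure.pi_map_pi (f := fun i x => ![σ₁, σ₂] i * x) (by fun_prop)]
  simp_rw [map_gaussianReal_const_mul]
  refine Measure.ext_of_charFun ?_
  ext t
  rw [charFun_pi, charFun_multivariateGaussian hpos]
  simp only [charFun_gaussianReal, ← Complex.exp_sum]
  congr 1
  simp [Fin.sum_univ_two, dotProduct, Matrix.mulVec_diagonal, max_eq_left (sq_nonneg _)]
  ring

/-- Slutsky's theorem in the form needed for the Sobel statistic: besides two consistent sequences,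
the deterministic sequence `n^{-1/2}` is available to the map, which recovers unnormalized estimators
from the asymptotically normal ones. -/
theorem tendstoInDistribution_comp_slutsky {Ω : Type*} [MeasurableSpace Ω] {P : Measure Ω}
    [IsProbabilityMeasure P] {Ω' : Type*} [MeasurableSpace Ω'] {P' : Measure Ω'}
    [IsProbabilityMeasure P'] {Y : ℕ → Ω → ℝ × ℝ} {W : Ω' → ℝ × ℝ}
    (hY : TendstoInDistribution Y atTop W (fun _ => P) P')
    {a b : ℕ → Ω → ℝ} {a₀ b₀ : ℝ} (ha : TendstoInMeasure P a atTop fun _ => a₀)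
    (hb : TendstoInMeasure P b atTop fun _ => b₀)
    (ham : ∀ n, Measurable (a n)) (hbm : ∀ n, Measurable (b n))
    {h : (ℝ × ℝ) × (ℝ × ℝ) × ℝ → ℝ} (hh : Measurable h)
    (hcont : ∀ᵐ ω ∂P', ContinuousAt h (W ω, (a₀, b₀), 0)) :
    TendstoInDistribution
      (fun n ω => h (Y n ω, (a n ω, b n ω), (√(n : ℝ))⁻¹)) atTop (fun ω => h (W ω, (a₀, b₀), 0))
      (fun _ => P) P' := by
  -- at `n = 0` the junk value `0⁻¹ = 0` is harmless, as the limit is along `atTop`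
  have hr : TendstoInMeasure P (fun (n : ℕ) _ => (√(n : ℝ))⁻¹) atTop fun _ => (0 : ℝ) :=
    tendstoInMeasure_of_tendsto_ae (fun n => aestronglyMeasurable_const)
      (Eventually.of_forall fun _ =>
        (Real.tendsto_sqrt_atTop.comp tendsto_natCast_atTop_atTop).inv_tendsto_atTop)
  exact tendstoInDistribution_comp_of_ae_continuousAt
    (hY.prodMk_of_tendstoInMeasure_const _ _ _ ((ha.prodMk hb).prodMk hr)
      fun n => by fun_prop) hh hcont

/-! ### The limit of the Sobel statistic -/

section SobelLimit

variable {Ω : Type*} [MeasurableSpace Ω] {P : Measure Ω} [IsProbabilityMeasure P]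
  {A B a b : ℕ → Ω → ℝ} {σ τ : ℝ}

/-- The limit of the Sobel statistic when exactly one of the two parameters vanishes: `A` estimates
`0` and `B` estimates `β ≠ 0`. -/
theorem tendstoInDistribution_sobel_of_ne_zero {β : ℝ} (hβ : β ≠ 0) (hσ : 0 < σ)
    (hAB : TendstoInDistribution (fun (n : ℕ) ω => (√(n : ℝ) * A n ω, √(n : ℝ) * (B n ω - β)))
      atTop (fun p : ℝ × ℝ => (σ * p.1, τ * p.2)) (fun _ => P)
      ((gaussianReal 0 1).prod (gaussianReal 0 1)))
    (ha : TendstoInMeasure P a atTop fun _ => σ ^ 2)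
    (hb : TendstoInMeasure P b atTop fun _ => τ ^ 2)
    (ham : ∀ n, Measurable (a n)) (hbm : ∀ n, Measurable (b n)) :
    TendstoInDistribution
      (fun (n : ℕ) ω => √(n : ℝ) * A n ω * B n ω / √(A n ω ^ 2 * b n ω + B n ω ^ 2 * a n ω))
      atTop id (fun _ => P) (gaussianReal 0 1) := by
  let h : (ℝ × ℝ) × (ℝ × ℝ) × ℝ → ℝ := fun q =>
    q.1.1 * (β + q.2.2 * q.1.2) /
      √((q.2.2 * q.1.1) ^ 2 * q.2.1.2 + (β + q.2.2 * q.1.2) ^ 2 * q.2.1.1)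
  have hlim := tendstoInDistribution_comp_slutsky hAB ha hb ham hbm (h := h)
    (by unfold h; fun_prop) (Eventually.of_forall fun p => by
      refine ContinuousAt.div (by fun_prop) (by fun_prop) ?_
      refine (Real.sqrt_pos.2 ?_).ne'
      simp only [zero_mul, add_zero, ne_eq, OfNat.ofNat_ne_zero, not_false_eq_true, zero_pow,
        zero_add]
      positivity)
  have hsq : (β / |β|) ^ 2 = 1 := by rw [div_pow, sq_abs, div_self (pow_ne_zero 2 hβ)]
  have hlaw : IdentDistrib (fun p : ℝ × ℝ => h ((σ * p.1, τ * p.2), (σ ^ 2, τ ^ 2), 0)) id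
      ((gaussianReal 0 1).prod (gaussianReal 0 1)) (gaussianReal 0 1) := by
    have heq : (fun p : ℝ × ℝ => h ((σ * p.1, τ * p.2), (σ ^ 2, τ ^ 2), 0)) =
        (fun x => β / |β| * x) ∘ Prod.fst := by
      ext p
      have hs : √(β ^ 2 * σ ^ 2) = |β| * σ := by
        rw [Real.sqrt_mul (sq_nonneg β), Real.sqrt_sq_eq_abs, Real.sqrt_sq hσ.le]
      have : |β| ≠ 0 := abs_ne_zero.2 hβ
      simp only [h, zero_mul, add_zero, ne_eq, OfNat.ofNat_ne_zero, not_false_eq_true, zero_pow,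
        zero_add, hs, Function.comp_apply]
      field_simp
    rw [heq]
    refine ⟨by fun_prop, by fun_prop, ?_⟩
    rw [← Measure.map_map (by fun_prop) measurable_fst, Measure.map_fst_prod, measure_univ,
      one_smul, map_gaussianReal_const_mul, hsq, Real.toNNReal_one, Measure.map_id]
  refine (hlim.congr_law hlaw).congr (fun n => Eventually.of_forall fun ω => ?_) EventuallyEq.rfl
  -- at `n = 0` both sides are `0`, because of the factor `√0`
  rcases Nat.eq_zero_or_pos n with rfl | hn
  · simp [h]
  · have hs : √(n : ℝ) ≠ 0 := (Real.sqrt_pos.2 (by exact_mod_cast hn)).ne'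
    simp only [h, inv_mul_cancel_left₀ hs, add_sub_cancel]

/-- The limit of the Sobel statistic when both parameters vanish has variance `1 / 4`. -/
theorem tendstoInDistribution_sobel_of_zero (hσ : 0 < σ) (hτ : 0 < τ)
    (hAB : TendstoInDistribution (fun (n : ℕ) ω => (√(n : ℝ) * A n ω, √(n : ℝ) * B n ω))
      atTop (fun p : ℝ × ℝ => (σ * p.1, τ * p.2)) (fun _ => P)
      ((gaussianReal 0 1).prod (gaussianReal 0 1)))
    (ha : TendstoInMeasure P a atTop fun _ => σ ^ 2)
    (hb : TendstoInMeasure P b atTop fun _ => τ ^ 2)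
    (ham : ∀ n, Measurable (a n)) (hbm : ∀ n, Measurable (b n)) :
    TendstoInDistribution
      (fun (n : ℕ) ω => √(n : ℝ) * A n ω * B n ω / √(A n ω ^ 2 * b n ω + B n ω ^ 2 * a n ω))
      atTop id (fun _ => P) (gaussianReal 0 (1 / 4)) := by
  let h : (ℝ × ℝ) × (ℝ × ℝ) × ℝ → ℝ := fun q =>
    q.1.1 * q.1.2 / √(q.1.1 ^ 2 * q.2.1.2 + q.1.2 ^ 2 * q.2.1.1)
  have hne : ∀ᵐ p ∂((gaussianReal 0 1).prod (gaussianReal 0 1)), p.1 ≠ 0 := by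
    exact Measure.quasiMeasurePreserving_fst.ae ae_gaussianReal_ne_zero
  have hlim := tendstoInDistribution_comp_slutsky hAB ha hb ham hbm (h := h)
    (by unfold h; fun_prop) (by
      filter_upwards [hne] with p hp
      refine ContinuousAt.div (by fun_prop) (by fun_prop) ?_
      exact (Real.sqrt_pos.2 (by positivity)).ne')
  have hlaw : IdentDistrib (fun p : ℝ × ℝ => h ((σ * p.1, τ * p.2), (σ ^ 2, τ ^ 2), 0)) id
      ((gaussianReal 0 1).prod (gaussianReal 0 1)) (gaussianReal 0 (1 / 4)) := by
    have heq : (fun p : ℝ × ℝ => h ((σ * p.1, τ * p.2), (σ ^ 2, τ ^ 2), 0)) =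
        fun p => p.1 * p.2 / √(p.1 ^ 2 + p.2 ^ 2) := by
      ext p
      have hs : √((σ * p.1) ^ 2 * τ ^ 2 + (τ * p.2) ^ 2 * σ ^ 2) =
          σ * τ * √(p.1 ^ 2 + p.2 ^ 2) := by
        rw [show (σ * p.1) ^ 2 * τ ^ 2 + (τ * p.2) ^ 2 * σ ^ 2 =
          (σ * τ) ^ 2 * (p.1 ^ 2 + p.2 ^ 2) by ring, Real.sqrt_mul (sq_nonneg _),
          Real.sqrt_sq (mul_pos hσ hτ).le]
      simp only [h, hs]
      rw [mul_mul_mul_comm, mul_div_mul_left _ _ (mul_pos hσ hτ).ne']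
    rw [heq]
    exact ⟨by fun_prop, by fun_prop, by rw [map_mul_div_sqrt_gaussianReal_prod, Measure.map_id]⟩
  refine (hlim.congr_law hlaw).congr (fun n => Eventually.of_forall fun ω => ?_) EventuallyEq.rfl
  -- one factor `√n` of the numerator cancels against the homogeneity of the denominator
  have hs : √((√(n : ℝ) * A n ω) ^ 2 * b n ω + (√(n : ℝ) * B n ω) ^ 2 * a n ω) =
      √(n : ℝ) * √(A n ω ^ 2 * b n ω + B n ω ^ 2 * a n ω) := by
    rw [← Real.sqrt_mul n.cast_nonneg]
    congr 1
    rw [mul_pow, mul_pow, Real.sq_sqrt n.cast_nonneg]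
    ring
  simp only [h, hs]
  -- at `n = 0` both sides are `0`, because of the factor `√0`
  rcases Nat.eq_zero_or_pos n with rfl | hn
  · simp
  · have hs : √(n : ℝ) ≠ 0 := (Real.sqrt_pos.2 (by exact_mod_cast hn)).ne'
    rw [mul_assoc, mul_div_mul_left _ _ hs, mul_left_comm, mul_assoc]

end SobelLimit

/-- Under the composite null hypothesis the Sobel statistic is asymptotically centred normal. The
standard deviation `c` is `1 / 2` if both parameters vanish and `1` otherwise. -/
theorem MediationEstimators.exists_tendstoInDistribution_sobel
    {𝒳 Ω : Type*} [MeasurableSpace 𝒳] [MeasurableSpace Ω]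
    {P : Measure Ω} [IsProbabilityMeasure P]
    {X : ℕ → Ω → 𝒳} (hX : ∀ j, Measurable (X j))
    {E : MediationEstimators 𝒳} {α β σ₁ σ₂ : ℝ} (hσ₁ : 0 < σ₁) (hσ₂ : 0 < σ₂)
    (hnormal : E.AsymptoticallyNormal P X α β σ₁ σ₂)
    (hcons : E.ConsistentVariances P X σ₁ σ₂) (hnull : α * β = 0) :
    ∃ c : ℝ, 0 < c ∧
      TendstoInDistribution (fun n ω => E.sobel n (fun j : Fin n => X j ω)) atTop id (fun _ => P)
        (gaussianReal 0 (Real.toNNReal (c ^ 2))) := by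
  have hXn : ∀ n, Measurable (fun ω (j : Fin n) => X j ω) := fun n => by fun_prop
  have hs₁ : ∀ n, Measurable fun ω => E.s₁ n (fun j => X j ω) ^ 2 := fun n =>
    ((E.measurable_s₁ n).comp (hXn n)).pow_const 2
  have hs₂ : ∀ n, Measurable fun ω => E.s₂ n (fun j => X j ω) ^ 2 := fun n =>
    ((E.measurable_s₂ n).comp (hXn n)).pow_const 2
  have hpair : TendstoInDistribution
      (fun (n : ℕ) ω => (√(n : ℝ) * (E.alphaHat n (fun j => X j ω) - α),
        √(n : ℝ) * (E.betaHat n (fun j => X j ω) - β)))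
      atTop (fun p : ℝ × ℝ => (σ₁ * p.1, σ₂ * p.2)) (fun _ => P)
      ((gaussianReal 0 1).prod (gaussianReal 0 1)) := by
    have h1 : TendstoInDistribution _ atTop
        (fun p : ℝ × ℝ => (!₂[σ₁ * p.1, σ₂ * p.2] : EuclideanSpace ℝ (Fin 2))) (fun _ => P)
        ((gaussianReal 0 1).prod (gaussianReal 0 1)) :=
      TendstoInDistribution.congr_law hnormal ⟨by fun_prop, by fun_prop, by
        rw [map_gaussianReal_prod_eq_multivariateGaussian, Measure.map_id]⟩
    exact h1.continuous_comp (g := fun x : EuclideanSpace ℝ (Fin 2) => (x 0, x 1)) (by fun_prop)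
  rcases eq_or_ne β 0 with rfl | hβ
  · rcases eq_or_ne α 0 with rfl | hα
    · refine ⟨1 / 2, by norm_num, ?_⟩
      rw [show Real.toNNReal ((1 / 2) ^ 2) = 1 / 4 by ext; norm_num]
      simp only [sub_zero] at hpair
      exact tendstoInDistribution_sobel_of_zero hσ₁ hσ₂ hpair hcons.1 hcons.2 hs₁ hs₂
    · refine ⟨1, one_pos, ?_⟩
      rw [one_pow, Real.toNNReal_one]
      -- the roles of the two estimators are exchanged
      have hswap : TendstoInDistribution
          (fun (n : ℕ) ω => (√(n : ℝ) * E.betaHat n (fun j => X j ω),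
            √(n : ℝ) * (E.alphaHat n (fun j => X j ω) - α)))
          atTop (fun p : ℝ × ℝ => (σ₂ * p.1, σ₁ * p.2)) (fun _ => P)
          ((gaussianReal 0 1).prod (gaussianReal 0 1)) := by
        simp only [sub_zero] at hpair
        refine (hpair.continuous_comp continuous_swap).congr_law
          ⟨by fun_prop, by fun_prop, ?_⟩
        have : Prod.swap ∘ (fun p : ℝ × ℝ => (σ₁ * p.1, σ₂ * p.2)) =
            (fun p : ℝ × ℝ => (σ₂ * p.1, σ₁ * p.2)) ∘ Prod.swap := rfl
        rw [this, ← Measure.map_map (by fun_prop) measurable_swap, Measure.prod_swap]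
      refine (tendstoInDistribution_sobel_of_ne_zero hα hσ₂ hswap hcons.2 hcons.1 hs₂ hs₁).congr
        (fun n => Eventually.of_forall fun ω => ?_) EventuallyEq.rfl
      simp only [sobel]
      rw [mul_right_comm, add_comm]
  · obtain rfl : α = 0 := (mul_eq_zero.1 hnull).resolve_right hβ
    refine ⟨1, one_pos, ?_⟩
    rw [one_pow, Real.toNNReal_one]
    simp only [sub_zero] at hpair
    exact tendstoInDistribution_sobel_of_ne_zero hβ hσ₁ hpair hcons.1 hcons.2 hs₁ hs₂

/-! ### Radial Gaussian integrals -/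

theorem pi_gaussianReal_eq_withDensity (ι : Type*) [Fintype ι] :
    (Measure.pi fun _ : ι => gaussianReal 0 1) = (volume : Measure (ι → ℝ)).withDensity
      fun x => ENNReal.ofReal (∏ i, gaussianPDFReal 0 1 (x i)) := by
  refine Measure.pi_eq fun s hs => ?_
  rw [withDensity_apply _ (MeasurableSet.univ_pi hs), volume_pi, Measure.restrict_pi_pi,
    ← ofReal_integral_eq_lintegral_ofReal, integral_fintype_prod_eq_prod,
    ENNReal.ofReal_prod_of_nonneg]
  · exact Finset.prod_congr rfl fun i _ => (gaussianReal_apply_eq_integral 0 one_ne_zero _).symm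
  · exact fun i _ => integral_nonneg fun x => gaussianPDFReal_nonneg 0 1 x
  · exact Integrable.fintype_prod fun i => (integrable_gaussianPDFReal 0 1).integrableOn
  · exact Eventually.of_forall fun x => Finset.prod_nonneg fun i _ => gaussianPDFReal_nonneg 0 1 _

theorem integral_norm_mul_exp_neg_mul_sq (k : ℕ) (hk : 0 < k) {b : ℝ} (hb : 0 < b) :
    ∫ v : EuclideanSpace ℝ (Fin k), ‖v‖ * Real.exp (-b * ‖v‖ ^ 2) =
      √Real.pi ^ k * Real.Gamma ((k + 1) / 2) / Real.Gamma (k / 2) *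
        b ^ (-((k + 1 : ℝ) / 2)) := by
  have : Nonempty (Fin k) := ⟨⟨0, hk⟩⟩
  have hk' : (0 : ℝ) < k := by exact_mod_cast hk
  rw [integral_fun_norm_addHaar volume fun r => r * Real.exp (-b * r ^ 2)]
  have hrad : ∫ y in Set.Ioi (0 : ℝ), y ^ (k - 1) • (y * Real.exp (-b * y ^ 2)) =
      b ^ (-((k + 1 : ℝ) / 2)) * (1 / 2) * Real.Gamma ((k + 1) / 2) := by
    have h1 := integral_rpow_mul_exp_neg_mul_rpow (p := 2) (q := k) (b := b) two_pos
      (by linarith) hb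
    rw [← neg_div, ← h1]
    refine setIntegral_congr_fun measurableSet_Ioi fun y hy => ?_
    simp only [smul_eq_mul, Real.rpow_natCast, Real.rpow_two]
    rw [← mul_assoc, ← pow_succ, Nat.sub_add_cancel hk]
  have hG : Real.Gamma ((k : ℝ) / 2 + 1) = k / 2 * Real.Gamma (k / 2) :=
    Real.Gamma_add_one (by positivity)
  have hGpos : 0 < Real.Gamma ((k : ℝ) / 2) := Real.Gamma_pos_of_pos (by positivity)
  rw [finrank_euclideanSpace_fin, hrad, Measure.real, EuclideanSpace.volume_ball, Fintype.card_fin,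
    ENNReal.ofReal_one, one_pow, one_mul, ENNReal.toReal_ofReal (by rw [hG]; positivity), hG]
  simp only [nsmul_eq_mul, smul_eq_mul]
  field_simp

/-- The integrand is `ρ * φ (ρ * t)`, with `φ` the standard normal density and `ρ` the root mean square
of `v`: it is the density at `t` of a standard normal variable divided by `ρ`. -/
theorem lintegral_pi_gaussianReal_norm {k : ℕ} (hk : 0 < k) (t : ℝ) :
    ∫⁻ v : Fin k → ℝ, ENNReal.ofReal (√(∑ i, v i ^ 2) / √k * (√(2 * Real.pi))⁻¹ *
        Real.exp (-(∑ i, v i ^ 2) * t ^ 2 / (2 * k)))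
      ∂(Measure.pi fun _ => gaussianReal 0 1) =
    ENNReal.ofReal (Real.Gamma ((k + 1) / 2) / (√(k * Real.pi) * Real.Gamma (k / 2)) *
      (1 + t ^ 2 / k) ^ (-((k + 1 : ℝ) / 2))) := by
  have hk' : (0 : ℝ) < k := by exact_mod_cast hk
  have hGpos : 0 < Real.Gamma ((k : ℝ) / 2) := Real.Gamma_pos_of_pos (by positivity)
  have hGpos' : 0 < Real.Gamma (((k : ℝ) + 1) / 2) := Real.Gamma_pos_of_pos (by positivity)
  set b : ℝ := (1 + t ^ 2 / k) / 2 with hbdef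
  have hb : 0 < b := by positivity
  set C : ℝ := (√(2 * Real.pi))⁻¹ ^ k * ((√k)⁻¹ * (√(2 * Real.pi))⁻¹) with hC
  have hCpos : 0 < C := by positivity
  rw [pi_gaussianReal_eq_withDensity, lintegral_withDensity_eq_lintegral_mul _ (by
    have := measurable_gaussianPDFReal 0 1
    fun_prop) (by fun_prop)]
  have hval := integral_norm_mul_exp_neg_mul_sq k hk hb
  -- a nonzero Bochner integral forces integrability
  have hint : Integrable fun v : EuclideanSpace ℝ (Fin k) => ‖v‖ * Real.exp (-b * ‖v‖ ^ 2) := by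
    refine Integrable.of_integral_ne_zero ?_
    rw [hval]
    positivity
  calc _ = ∫⁻ v : Fin k → ℝ, ENNReal.ofReal
        (C * (‖WithLp.toLp 2 v‖ * Real.exp (-b * ‖WithLp.toLp 2 v‖ ^ 2))) := by
        refine lintegral_congr fun v => ?_
        have hprod : ∏ i, gaussianPDFReal 0 1 (v i) =
            (√(2 * Real.pi))⁻¹ ^ k * Real.exp (-(∑ i, v i ^ 2) / 2) := by
          simp only [gaussianPDFReal, sub_zero, NNReal.coe_one, mul_one, Finset.prod_mul_distrib,
            Finset.prod_const, Finset.card_univ, Fintype.card_fin, ← Real.exp_sum]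
          rw [← Finset.sum_div, Finset.sum_neg_distrib]
        have hsum : 0 ≤ ∑ i, v i ^ 2 := Finset.sum_nonneg fun i _ => sq_nonneg _
        simp only [Pi.mul_apply]
        rw [← ENNReal.ofReal_mul (Finset.prod_nonneg fun i _ => gaussianPDFReal_nonneg 0 1 _),
          hprod, EuclideanSpace.norm_eq]
        simp only [Real.norm_eq_abs, sq_abs]
        rw [Real.sq_sqrt hsum]
        congr 1
        have hexp : Real.exp (-b * ∑ i, v i ^ 2) = Real.exp (-(∑ i, v i ^ 2) / 2) *
            Real.exp (-(∑ i, v i ^ 2) * t ^ 2 / (2 * k)) := by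
          rw [← Real.exp_add]
          congr 1
          rw [hbdef]
          field_simp
          ring
        rw [hexp, hC]
        ring
    _ = ∫⁻ v : EuclideanSpace ℝ (Fin k), ENNReal.ofReal
        (C * (‖v‖ * Real.exp (-b * ‖v‖ ^ 2))) :=
        (PiLp.volume_preserving_toLp (Fin k)).lintegral_comp
          (f := fun v => ENNReal.ofReal (C * (‖v‖ * Real.exp (-b * ‖v‖ ^ 2)))) (by fun_prop)
    _ = _ := by
        rw [← ofReal_integral_eq_lintegral_ofReal (hint.const_mul C)
          (Eventually.of_forall fun v => by positivity), integral_const_mul, hval]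
        congr 1
        have hbp : b ^ (-((k + 1 : ℝ) / 2)) =
            (1 + t ^ 2 / k) ^ (-((k + 1 : ℝ) / 2)) * √2 ^ (k + 1) := by
          have h2 : (2 : ℝ) ^ ((k + 1 : ℝ) / 2) = √2 ^ (k + 1) := by
            rw [Real.sqrt_eq_rpow, ← Real.rpow_natCast, ← Real.rpow_mul zero_le_two]
            congr 1
            push_cast
            ring
          rw [hbdef, Real.div_rpow (by positivity) zero_le_two, Real.rpow_neg zero_le_two,
            div_inv_eq_mul, h2]
        rw [hbp, hC, Real.sqrt_mul zero_le_two, Real.sqrt_mul hk'.le]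
        field_simp
        rw [div_pow, mul_pow, one_pow, pow_succ]
        field_simp

/-! ### Student's law -/

/-- A standard normal variable over the root mean square of `k` independent ones has Student's law. -/
theorem map_div_sqrt_sum_sq_eq_studentT {k : ℕ} (hk : 0 < k) :
    ((gaussianReal 0 1).prod (Measure.pi fun _ : Fin k => gaussianReal 0 1)).map
      (fun p => p.1 / √(1 / k * ∑ i, p.2 i ^ 2)) = studentT k := by
  have hk' : (0 : ℝ) < k := by exact_mod_cast hk
  refine Measure.ext_of_lintegral _ fun f hf => ?_
  have hmeas : Measurable fun p : ℝ × (Fin k → ℝ) => p.1 / √(1 / k * ∑ i, p.2 i ^ 2) := by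
    fun_prop
  rw [lintegral_map hf hmeas, lintegral_prod_symm'
    (fun p : ℝ × (Fin k → ℝ) => f (p.1 / √(1 / k * ∑ i, p.2 i ^ 2))) (hf.comp hmeas)]
  -- conditionally on the denominator, the ratio is a centred Gaussian variable
  have hcond : ∀ v : Fin k → ℝ, v ⟨0, hk⟩ ≠ 0 →
      ∫⁻ x, f (x / √(1 / k * ∑ i, v i ^ 2)) ∂(gaussianReal 0 1) =
        ∫⁻ t, f t * ENNReal.ofReal (√(∑ i, v i ^ 2) / √k * (√(2 * Real.pi))⁻¹ *
          Real.exp (-(∑ i, v i ^ 2) * t ^ 2 / (2 * k))) := by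
    intro v hv
    have hs : 0 < ∑ i, v i ^ 2 := Finset.sum_pos' (fun i _ => sq_nonneg _)
      ⟨⟨0, hk⟩, Finset.mem_univ _, by positivity⟩
    set q := ∑ i, v i ^ 2
    set r := √(1 / k * q) with hr
    have hrpos : 0 < r := Real.sqrt_pos.2 (by positivity)
    have hr2 : r ^ 2 = q / k := by
      rw [hr, Real.sq_sqrt (by positivity)]
      ring
    have hrq : r = √q / √k := by rw [hr, one_div_mul_eq_div, Real.sqrt_div hs.le]
    have hvar : Real.toNNReal (r⁻¹ ^ 2) ≠ 0 := (Real.toNNReal_pos.2 (by positivity)).ne'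
    have hmap : (gaussianReal 0 1).map (fun x => x / r) =
        gaussianReal 0 (Real.toNNReal (r⁻¹ ^ 2)) := by
      simp_rw [div_eq_inv_mul]
      exact map_gaussianReal_const_mul r⁻¹
    rw [← lintegral_map hf (by fun_prop : Measurable fun x => x / r), hmap,
      gaussianReal_of_var_ne_zero _ hvar,
      lintegral_withDensity_eq_lintegral_mul _ (measurable_gaussianPDF _ _) hf]
    refine lintegral_congr fun t => ?_
    rw [Pi.mul_apply, mul_comm, gaussianPDF, gaussianPDFReal, Real.coe_toNNReal _ (sq_nonneg _)]
    simp only [sub_zero]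
    congr 3
    · rw [Real.sqrt_mul (by positivity), Real.sqrt_sq (by positivity), ← hrq]
      field_simp
    · rw [inv_pow, hr2]
      field_simp
  have hne : ∀ᵐ v ∂(Measure.pi fun _ : Fin k => gaussianReal 0 1), v ⟨0, hk⟩ ≠ 0 := by
    exact (measurePreserving_eval (fun _ : Fin k => gaussianReal 0 1)
      ⟨0, hk⟩).quasiMeasurePreserving.ae ae_gaussianReal_ne_zero
  rw [lintegral_congr_ae (hne.mono hcond), lintegral_lintegral_swap (by fun_prop)]
  have hdens : Measurable fun t : ℝ => ENNReal.ofReal (Real.Gamma ((k + 1) / 2) /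
      (√(k * Real.pi) * Real.Gamma (k / 2)) * (1 + t ^ 2 / k) ^ (-((k + 1 : ℝ) / 2))) := by
    fun_prop
  rw [studentT, lintegral_withDensity_eq_lintegral_mul _ hdens hf]
  refine lintegral_congr fun t => ?_
  rw [lintegral_const_mul _ (by fun_prop), lintegral_pi_gaussianReal_norm hk, Pi.mul_apply,
    mul_comm]

theorem sum_sub_sampleMean_sq {K : ℕ} (hK : 0 < K) (v : Fin K → ℝ) :
    ∑ i, (v i - sampleMean v) ^ 2 = ∑ i, v i ^ 2 - (√K * sampleMean v) ^ 2 := by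
  have hK' : (0 : ℝ) < K := by exact_mod_cast hK
  have hsum : ∑ i, v i = K * sampleMean v := by
    rw [sampleMean]
    field_simp
  simp only [sub_sq, Finset.sum_add_distrib, Finset.sum_sub_distrib, ← Finset.sum_mul,
    ← Finset.mul_sum, hsum, Finset.sum_const, Finset.card_univ, Fintype.card_fin, nsmul_eq_mul,
    mul_pow, Real.sq_sqrt hK'.le]
  ring

/-- The studentized mean of `k + 1` independent standard normals has Student's law with `k` degrees of
freedom: in an orthonormal basis starting with the normalized constant vector, the first coordinate
is the numerator and the others carry the sum of squares. -/
theorem map_studentizedMean_pi_gaussianReal {k : ℕ} (hk : 0 < k) :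
    (Measure.pi fun _ : Fin (k + 1) => gaussianReal 0 1).map studentizedMean = studentT k := by
  have hk' : (0 : ℝ) < k + 1 := by positivity
  let u : EuclideanSpace ℝ (Fin (k + 1)) := WithLp.toLp 2 fun _ => (√(k + 1 : ℝ))⁻¹
  have hu : ‖u‖ = 1 := by
    rw [EuclideanSpace.norm_eq]
    simp only [u, Real.norm_eq_abs, sq_abs, inv_pow, Real.sq_sqrt hk'.le, Finset.sum_const,
      Finset.card_univ, Fintype.card_fin, nsmul_eq_mul, Nat.cast_add, Nat.cast_one]
    rw [mul_inv_cancel₀ hk'.ne', Real.sqrt_one]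
  obtain ⟨b, hb⟩ := Orthonormal.exists_orthonormalBasis_extension_of_card_eq
    (ι := Fin (k + 1)) (v := fun _ => u) (s := {0}) (𝕜 := ℝ) (by simp)
    ⟨fun _ => hu, fun i j hij => absurd (Subsingleton.elim i j) hij⟩
  have hb0 : b 0 = u := hb 0 rfl
  let Φ : (Fin (k + 1) → ℝ) → ℝ := fun y => y 0 / √(1 / k * ∑ i : Fin k, y i.succ ^ 2)
  have hΦ : Measurable Φ := by unfold Φ; fun_prop
  have hcoord : ∀ x : EuclideanSpace ℝ (Fin (k + 1)),
      studentizedMean x.ofLp = Φ (b.repr x).ofLp := by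
    intro x
    have h0 : (b.repr x).ofLp 0 = √(k + 1 : ℝ) * sampleMean x.ofLp := by
      rw [b.repr_apply_apply, hb0, PiLp.inner_apply]
      simp only [u, sampleMean, RCLike.inner_apply, conj_trivial, ← Finset.sum_mul, Nat.cast_add,
        Nat.cast_one]
      rw [← mul_div_assoc, mul_comm, eq_div_iff hk'.ne']
      nth_rewrite 2 [← Real.mul_self_sqrt hk'.le]
      field_simp
    have hnorm : ∑ i, (b.repr x).ofLp i ^ 2 = ∑ i, x.ofLp i ^ 2 := by
      have := b.repr.norm_map x
      rw [← sq_eq_sq₀ (norm_nonneg _) (norm_nonneg _), EuclideanSpace.norm_sq_eq,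
        EuclideanSpace.norm_sq_eq] at this
      simpa using this
    have hsucc : ∑ i : Fin k, (b.repr x).ofLp i.succ ^ 2 =
        ∑ i, (x.ofLp i - sampleMean x.ofLp) ^ 2 := by
      rw [sum_sub_sampleMean_sq k.succ_pos, ← hnorm, Fin.sum_univ_succ, h0]
      push_cast
      ring
    simp only [studentizedMean, Φ, hsucc, h0]
    push_cast
    rw [add_sub_cancel_right]
  have hrot : (Measure.pi fun _ : Fin (k + 1) => gaussianReal 0 1).map studentizedMean =
      (Measure.pi fun _ : Fin (k + 1) => gaussianReal 0 1).map Φ := by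
    have h1 : ∀ g : (Fin (k + 1) → ℝ) → ℝ, Measurable g →
        (Measure.pi fun _ : Fin (k + 1) => gaussianReal 0 1).map g =
          (stdGaussian (EuclideanSpace ℝ (Fin (k + 1)))).map fun x => g x.ofLp := fun g hg => by
      rw [← map_pi_eq_stdGaussian, Measure.map_map (by fun_prop) (by fun_prop)]
      rfl
    rw [h1 _ measurable_studentizedMean, h1 _ hΦ]
    conv_rhs => rw [← stdGaussian_map b.repr]
    rw [Measure.map_map (by fun_prop) (by fun_prop)]
    congr 1
    ext x
    exact hcoord x
  rw [hrot, ← map_div_sqrt_sum_sq_eq_studentT hk,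
    ← (measurePreserving_piFinSuccAbove (fun _ : Fin (k + 1) => gaussianReal 0 1) 0).map_eq,
    Measure.map_map (by fun_prop) (MeasurableEquiv.measurable _)]
  congr 1

theorem theorem2
    {𝒳 Ω Ω' : Type*} [MeasurableSpace 𝒳] [MeasurableSpace Ω] [MeasurableSpace Ω']
    (P : Measure Ω) [IsProbabilityMeasure P] (P' : Measure Ω') [IsProbabilityMeasure P']
    -- i.i.d. observations
    (X : ℕ → Ω → 𝒳) (hX : ∀ j, Measurable (X j)) (hindep : iIndepFun X P)
    (hident : ∀ j, IdentDistrib (X j) (X 0) P P)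
    -- the estimators and the assumptions on them
    (E : MediationEstimators 𝒳) (α β σ₁ σ₂ : ℝ) (hσ₁ : 0 < σ₁) (hσ₂ : 0 < σ₂)
    (hnormal : E.AsymptoticallyNormal P X α β σ₁ σ₂)
    (hcons : E.ConsistentVariances P X σ₁ σ₂)
    -- the composite null hypothesis
    (hnull : α * β = 0)
    -- splits of the first `n` observations into `K` parts, possibly random but independent of
    -- the data, with part sizes that tend to infinity in probability
    (K : ℕ) (hK : 2 ≤ K)
    (g : (n : ℕ) → Ω → Fin n → Fin K) (hg : ∀ n, Measurable (g n))
    (hgX : ∀ n, IndepFun (g n) (fun ω (j : Fin n) => X j ω) P)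
    (hsize : ∀ (i : Fin K) (m : ℕ),
      Tendsto (fun n => P {ω | (splitPart (g n ω) i).card ≤ m}) atTop (𝓝 0))
    -- i.i.d. standard normal variables
    (Z : Fin K → Ω' → ℝ) (hZ : ∀ i, HasLaw (Z i) (gaussianReal 0 1) P')
    (hZindep : iIndepFun Z P') :
    TendstoInDistribution (fun (n : ℕ) ω => subsamplingT E (g n ω) (fun j => X j ω)) atTop
      (fun ω' => studentizedMean (fun i => Z i ω')) (fun _ => P) P' ∧
    HasLaw (fun ω' => studentizedMean (fun i => Z i ω')) (studentT ((K : ℝ) - 1)) P' := by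
  have hZlaw : HasLaw (fun ω' i => Z i ω') (Measure.pi fun _ => gaussianReal 0 1) P' :=
    hZindep.hasLaw_pi hZ
  constructor
  · obtain ⟨c, hc, hsobel⟩ :=
      E.exists_tendstoInDistribution_sobel hX hσ₁ hσ₂ hnormal hcons hnull
    have hscale : HasLaw (fun ω' i => c * Z i ω')
        (Measure.pi fun _ => gaussianReal 0 (Real.toNNReal (c ^ 2))) P' := by
      refine HasLaw.fun_comp (Y := fun (z : Fin K → ℝ) i => c * z i)
        ⟨Measurable.aemeasurable (by fun_prop), ?_⟩ hZlaw
      rw [Measure.pi_map_pi (f := fun _ x => c * x) (by fun_prop)]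
      simp_rw [map_gaussianReal_const_mul]
    have hE : ∀ m, Measurable (E.sobel m) := fun m => by
      have := E.measurable_alphaHat m
      have := E.measurable_betaHat m
      have := E.measurable_s₁ m
      have := E.measurable_s₂ m
      unfold MediationEstimators.sobel
      fun_prop
    have hvec := tendstoInDistribution_subsampleStatistics hX hindep hident hE hsobel hg hgX
      hsize hscale
    have : NullSingletonClass (gaussianReal 0 (Real.toNNReal (c ^ 2))) :=
      nullSingletonClass_gaussianReal (Real.toNNReal_pos.2 (pow_pos hc 2)).ne'
    have hne : ∀ᵐ v ∂(Measure.pi fun _ : Fin K => gaussianReal 0 (Real.toNNReal (c ^ 2))),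
        v ⟨0, by omega⟩ ≠ v ⟨1, by omega⟩ := ae_pi_ne _ (by simp)
    rw [← hscale.map_eq] at hne
    have hT := tendstoInDistribution_comp_of_ae_continuousAt hvec measurable_studentizedMean
      ((ae_of_ae_map hscale.aemeasurable hne).mono fun ω' h => continuousAt_studentizedMean hK h)
    -- the unknown scale `c` cancels in the studentized mean
    simp only [studentizedMean_smul hc] at hT
    exact hT
  · obtain ⟨k, rfl⟩ : ∃ k, K = k + 1 := ⟨K - 1, by omega⟩
    have hlaw := map_studentizedMean_pi_gaussianReal (k := k) (by omega)
    rw [show ((k + 1 : ℕ) : ℝ) - 1 = k by push_cast; ring]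
    exact HasLaw.fun_comp (Y := studentizedMean)
      ⟨measurable_studentizedMean.aemeasurable, hlaw⟩ hZlaw
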